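/- For each $n\ge 1$ let $p=p_n\in[0,1]$, let $\eta_1,\dots,\eta_{n+1}$ be independent Bernoulli random variables with $P(\eta_j=1)=p=1-P(\eta_j=0)$, and let $$\tilde S=\sum_{j=1}^{n}\eta_j(1-\eta_{j+1}),\qquad \alpha=p(1-p),\qquad N=\left\lfloor \frac{n^2}{3n-2}\right\rfloor,\qquad \tilde p=\frac{n\alpha}{N}.$$ Write $$\mathrm{Bi}(N,\tilde p)\{k\}=\binom{N}{k}\tilde p^{\,k}(1-\tilde p)^{N-k},\qquad k=0,1,2,\dots,$$ with the value $0$ for $k>N$. Let $x=x_n$ be non-negative integers, and assume that, as $n\to\infty$, $p\to0$, $np\to\infty$ and $$|x-n\alpha|=o\bigl(\min(np,\,n^{2/3})\bigr).$$ Then, as $n\to\infty$, $$\frac{P(\tilde S=x)}{\mathrm{Bi}(N,\tilde p)\{x\}}\longrightarrow 1 .$$ -/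

import Mathlib

open MeasureTheory ProbabilityTheory Filter Topology Asymptotics

/-- The statistic `∑_{j=1}^n η_j (1 - η_{j+1})` of `n + 1` random variables
`η_1, …, η_{n+1}` (here indexed from `0` to `n`). -/
def countN11 {Ω : Type*} {n : ℕ} (η : Fin (n + 1) → Ω → ℝ) (ω : Ω) : ℝ :=
  ∑ j : Fin n, η j.castSucc ω * (1 - η j.succ ω)

/-- `α(p) = p (1 - p)`. -/
def alphaN11 (p : ℝ) : ℝ := p * (1 - p)

/-- The number of trials `N = ⌊n² / (3n - 2)⌋` of the approximating binomial law. -/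
noncomputable def binN (n : ℕ) : ℕ := ⌊(n : ℝ) ^ 2 / (3 * (n : ℝ) - 2)⌋₊

/-- The success probability `n α(p) / N` of the approximating binomial law. -/
noncomputable def binP (n : ℕ) (p : ℝ) : ℝ := (n : ℝ) * alphaN11 p / (binN n : ℝ)

/-- The binomial weight `Bi(N, q){k} = C(N, k) q^k (1 - q)^(N - k)` (it is `0` for `k > N`). -/
noncomputable def binomialWeight (N : ℕ) (q : ℝ) (k : ℕ) : ℝ :=
  (N.choose k : ℝ) * q ^ k * (1 - q) ^ (N - k)

/-! The generating function of the count satisfies a Fibonacci-type recurrence in `α (X - 1)`, and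
the polynomials `fibPoly` have only real negative zeros, explicit through sines (`fibPoly_eq_prod`).
For small `p` the count is therefore distributed as a sum of independent Bernoulli variables with
success probabilities `α * fibRoot (n + 1) i`. Their sum is `n α` and their squares sum to `(3 n -
2) α ^ 2`. The binomial law has the same mean, and `N` is chosen so that its sum of squares `n ^ 2 α
^ 2 / N` agrees up to `O(α ^ 2)`.

Two such laws are compared at `x` by exponential tilting with a common parameter `s`, chosen so that
the tilted binomial has mean `x` (`tendsto_coeff_div_coeff_poissonBinomialPoly`). The powers `(1 +
s) ^ x` cancel. In the logarithm of the normalising products the linear terms cancel, the quadratic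
ones differ by `O(s ^ 2 α ^ 2)`, and the cubic remainder is `O(|x - n α| ^ 3 / n ^ 2)`, which is
where `n ^ (2 / 3)` enters. Both tilted laws have mean `x + o(√x)` and uniformly small success
probabilities, so a local limit theorem (`tendsto_sqrt_mul_coeff_poissonBinomialPoly`) gives their
weights at `x` the same asymptotics. -/

/-! ### Descents of Bernoulli words and their generating polynomial -/

open Polynomial in
/-- The Fibonacci-type polynomials `F₀ = F₁ = 1`, `F_{n+2} = F_{n+1} + X F_n`. -/
noncomputable def fibPoly : ℕ → Polynomial ℝ
  | 0 => 1
  | 1 => 1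
  | n + 2 => fibPoly (n + 1) + X * fibPoly n

/-- The probability of the binary word `b` under independent Bernoulli letters. -/
noncomputable def wordWeight (p : ℝ) {n : ℕ} (b : Fin n → Bool) : ℝ :=
  ∏ i, if b i then p else 1 - p

/-- The number of descents `10` in a binary word. -/
def descents {n : ℕ} (b : Fin (n + 1) → Bool) : ℕ :=
  ∑ j : Fin n, if b j.castSucc ∧ ¬ b j.succ then 1 else 0

lemma wordWeight_cons (p : ℝ) {n : ℕ} (c : Bool) (b : Fin n → Bool) :
    wordWeight p (Fin.cons c b : Fin (n + 1) → Bool) =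
      (if c then p else 1 - p) * wordWeight p b := by
  simp [wordWeight, Fin.prod_univ_succ]

lemma descents_cons {n : ℕ} (c d : Bool) (b : Fin n → Bool) :
    descents (Fin.cons c (Fin.cons d b : Fin (n + 1) → Bool) : Fin (n + 2) → Bool) =
      (if c ∧ ¬ d then 1 else 0) + descents (Fin.cons d b : Fin (n + 1) → Bool) := by
  simp only [descents]
  rw [Fin.sum_univ_succ]
  simp

open Polynomial in
/-- The generating polynomial of descents over the words of length `n + 1` starting with `c`. -/
noncomputable def descentPoly (p : ℝ) (n : ℕ) (c : Bool) : Polynomial ℝ :=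
  ∑ b : Fin n → Bool, C (wordWeight p (Fin.cons c b : Fin (n + 1) → Bool)) *
    X ^ descents (Fin.cons c b : Fin (n + 1) → Bool)

lemma sum_fin_succ_bool {M : Type*} [AddCommMonoid M] {n : ℕ} (f : (Fin (n + 1) → Bool) → M) :
    ∑ b, f b = ∑ c : Bool, ∑ b : Fin n → Bool, f (Fin.cons c b) := by
  rw [← Fintype.sum_prod_type' (f := fun c b => f (Fin.cons c b))]
  exact (Fintype.sum_equiv (Fin.consEquiv fun _ : Fin (n + 1) => Bool) _ _ fun x => rfl).symm

open Polynomial in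
lemma descentPoly_succ (p : ℝ) (n : ℕ) (c : Bool) :
    descentPoly p (n + 1) c = C (if c then p else 1 - p) *
      ∑ d : Bool, X ^ (if c ∧ ¬ d then 1 else 0) * descentPoly p n d := by
  unfold descentPoly
  rw [sum_fin_succ_bool, Finset.mul_sum]
  refine Finset.sum_congr rfl fun d _ => ?_
  rw [Finset.mul_sum, Finset.mul_sum]
  refine Finset.sum_congr rfl fun b _ => ?_
  rw [wordWeight_cons, descents_cons, pow_add, C_mul]
  ring

-- A leading `0` creates no descent, so it only contributes a factor `1 - p`. A leading `1`
-- contributes `p`, with an extra `X` when the next letter is `0`. Adding the two cases, the total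
-- for one more letter is the old total plus `p (X - 1)` times the part starting with `0`, which is
-- the recurrence of `fibPoly`. The two claims are proved together because this step uses both.
open Polynomial in
lemma descentPoly_eq_fibPoly (p : ℝ) (n : ℕ) :
    descentPoly p n false = C (1 - p) * (fibPoly n).comp (C (p * (1 - p)) * (X - 1)) ∧
    descentPoly p n true + descentPoly p n false =
      (fibPoly (n + 1)).comp (C (p * (1 - p)) * (X - 1)) := by
  induction n with
  | zero => simp [descentPoly, fibPoly, wordWeight, descents]
  | succ n ih =>
    have h1 : descentPoly p (n + 1) false =
        C (1 - p) * (descentPoly p n true + descentPoly p n false) := by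
      simp [descentPoly_succ]
    have h2 : descentPoly p (n + 1) true =
        C p * (descentPoly p n true + X * descentPoly p n false) := by
      simp [descentPoly_succ]
    refine ⟨by rw [h1, ih.2], ?_⟩
    rw [h1, h2]
    simp only [fibPoly, add_comp, mul_comp, X_comp]
    rw [← ih.2]
    have h3 : (C (1 - p) : Polynomial ℝ) = 1 - C p := by simp
    have h4 := ih.1
    generalize (fibPoly n).comp (C (p * (1 - p)) * (X - 1)) = Q at h4 ⊢
    rw [C_mul]
    rw [h3] at h4 ⊢
    linear_combination (C p * (X - 1)) * h4

open Polynomial in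
lemma sum_words_eq_fibPoly (p : ℝ) (n : ℕ) :
    ∑ b : Fin (n + 1) → Bool, C (wordWeight p b) * X ^ descents b =
      (fibPoly (n + 1)).comp (C (p * (1 - p)) * (X - 1)) := by
  rw [← (descentPoly_eq_fibPoly p n).2, sum_fin_succ_bool]
  simp [descentPoly]

open Polynomial in
lemma sum_words_descents_eq (p : ℝ) (n k : ℕ) :
    ∑ b : Fin (n + 1) → Bool, (if descents b = k then wordWeight p b else 0) =
      ((fibPoly (n + 1)).comp (C (p * (1 - p)) * (X - 1))).coeff k := by
  rw [← sum_words_eq_fibPoly, finsetSum_coeff]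
  refine Finset.sum_congr rfl fun b _ => ?_
  rw [coeff_C_mul_X_pow]
  simp [eq_comm]

lemma measureReal_word {Ω : Type*} [MeasurableSpace Ω] {μ : Measure Ω} [IsProbabilityMeasure μ]
    {p : unitInterval} {n : ℕ} {η : Fin n → Ω → ℝ}
    (hη : ∀ j, HasLaw (η j) (bernoulliMeasure (1 : ℝ) 0 p) μ) (hi : iIndepFun η μ)
    (b : Fin n → Bool) :
    μ.real {ω | ∀ j, η j ω = if b j then 1 else 0} = wordWeight p b := by
  have h := hi.measure_inter_preimage_eq_mul (S := Finset.univ)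
    (sets := fun j => {if b j then (1 : ℝ) else 0}) (fun j _ => measurableSet_singleton _)
  have e : {ω | ∀ j, η j ω = if b j then 1 else 0} =
      ⋂ j ∈ Finset.univ, η j ⁻¹' {if b j then (1 : ℝ) else 0} := by
    ext ω; simp
  rw [e, measureReal_def, h, ENNReal.toReal_prod, wordWeight]
  refine Finset.prod_congr rfl fun j _ => ?_
  have h2 := (hη j).measureReal_eq (p := fun y => y = if b j then (1 : ℝ) else 0)
    (measurableSet_singleton _)
  change μ.real {ω | η j ω = if b j then 1 else 0} = _
  rw [h2, bernoulliMeasure_real_apply p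
    (show MeasurableSet {y : ℝ | y = if b j then (1 : ℝ) else 0} from measurableSet_singleton _)]
  cases b j <;> simp

lemma ae_zero_or_one {Ω : Type*} [MeasurableSpace Ω] {μ : Measure Ω}
    {p : unitInterval} {X : Ω → ℝ} (hX : HasLaw X (bernoulliMeasure (1 : ℝ) 0 p) μ) :
    ∀ᵐ ω ∂μ, X ω = 0 ∨ X ω = 1 := by
  have hm : MeasurableSet {y : ℝ | ¬ (y = 0 ∨ y = 1)} := by measurability
  have h := hX.measure_eq hm
  rw [ae_iff, h, bernoulliMeasure_apply_of_notMem_of_notMem p hm (by simp) (by simp)]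

open Polynomial in
/-- The law of the descent count of a Bernoulli word. -/
lemma measureReal_countN11_eq {Ω : Type*} [MeasurableSpace Ω] {μ : Measure Ω}
    [IsProbabilityMeasure μ] {p : unitInterval} {n : ℕ} {η : Fin (n + 1) → Ω → ℝ}
    (hη : ∀ j, HasLaw (η j) (bernoulliMeasure (1 : ℝ) 0 p) μ) (hi : iIndepFun η μ) (k : ℕ) :
    μ.real {ω | countN11 η ω = k} =
      ((fibPoly (n + 1)).comp (C (alphaN11 p) * (X - 1))).coeff k := by
  classical
  rw [alphaN11, ← sum_words_descents_eq, ← Finset.sum_filter]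
  have hcount : ∀ (b : Fin (n + 1) → Bool) ω, (∀ j, η j ω = if b j then 1 else 0) →
      countN11 η ω = descents b := by
    intro b ω h
    simp only [countN11, descents, h, Nat.cast_sum]
    refine Finset.sum_congr rfl fun j _ => ?_
    cases b j.castSucc <;> cases b j.succ <;> simp
  -- Off the null set where some `η j` is neither `0` nor `1`, the event is the disjoint union of
  -- the words with `k` descents.
  have hae : {ω | countN11 η ω = k} =ᵐ[μ]
      ⋃ b ∈ Finset.univ.filter (fun b : Fin (n + 1) → Bool => descents b = k),
        {ω | ∀ j, η j ω = if b j then 1 else 0} := by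
    filter_upwards [ae_all_iff.2 fun j => ae_zero_or_one (hη j)] with ω hω
    apply propext
    change ω ∈ {ω | countN11 η ω = k} ↔ ω ∈ (⋃ b ∈ _, _)
    simp only [Set.mem_ofPred_eq, Set.mem_iUnion, Finset.mem_filter, Finset.mem_univ, true_and,
      exists_prop]
    constructor
    · intro h
      have hb : ∀ j, η j ω = if (decide (η j ω = 1)) then 1 else 0 := by
        intro j
        rcases hω j with h | h <;> simp [h]
      refine ⟨fun j => decide (η j ω = 1), ?_, hb⟩
      have := hcount _ ω hb
      rw [h] at this
      exact_mod_cast this.symm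
    · rintro ⟨b, hb, h⟩
      rw [hcount b ω h, hb]
  rw [measureReal_congr hae, measureReal_biUnion_finset₀]
  · exact Finset.sum_congr rfl fun b _ => measureReal_word hη hi b
  · intro b _ b' _ hbb
    refine Disjoint.aedisjoint (Set.disjoint_left.2 fun ω h h' => hbb ?_)
    ext j
    have := (h j).symm.trans (h' j)
    cases hb : b j <;> cases hb' : b' j <;> simp_all
  · intro b _
    have : {ω | ∀ j, η j ω = if b j then 1 else 0} =
        ⋂ j, η j ⁻¹' {if b j then (1 : ℝ) else 0} := by
      ext ω; simp
    rw [this]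
    exact NullMeasurableSet.iInter fun j =>
      (hη j).aemeasurable.nullMeasurableSet_preimage (measurableSet_singleton _)

/-! ### Zeros of the Fibonacci-type polynomials and their power sums -/

open Polynomial in
lemma fibPoly_natDegree_le (n : ℕ) : (fibPoly n).natDegree ≤ n / 2 := by
  induction n using fibPoly.induct with
  | case1 => simp [fibPoly]
  | case2 => simp [fibPoly]
  | case3 n ih1 ih2 =>
    rw [fibPoly]
    refine (natDegree_add_le _ _).trans (max_le (by omega) ?_)
    refine natDegree_mul_le.trans ?_
    have := natDegree_X_le (R := ℝ)
    omega

-- After scaling, the recurrence becomes that of the Chebyshev polynomials of the second kind, `sin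
-- ((m + 1) θ) = 2 cos θ sin (m θ) - sin ((m - 1) θ)`. Zeros thus arise where `(n + 1) θ` is a
-- multiple of `π`.
open Polynomial in
lemma fibPoly_eval_cos (n : ℕ) (θ : ℝ) (hc : Real.cos θ ≠ 0) :
    (fibPoly n).eval (-(4 * Real.cos θ ^ 2)⁻¹) * (2 * Real.cos θ) ^ n * Real.sin θ =
      Real.sin ((n + 1) * θ) := by
  induction n using fibPoly.induct with
  | case1 => simp [fibPoly]
  | case2 =>
    have : ((1 : ℕ) + 1 : ℝ) * θ = 2 * θ := by norm_num
    rw [this, Real.sin_two_mul]; simp [fibPoly]; ring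
  | case3 n ih1 ih2 =>
    rw [fibPoly, eval_add, eval_mul, eval_X]
    have e : Real.sin (((n + 2 : ℕ) + 1) * θ) =
        2 * Real.cos θ * Real.sin (((n + 1 : ℕ) + 1) * θ) - Real.sin ((n + 1) * θ) := by
      have h1 : ((n + 2 : ℕ) + 1 : ℝ) * θ = ((n + 1 : ℕ) + 1 : ℝ) * θ + θ := by push_cast; ring
      have h2 : ((n : ℝ) + 1) * θ = ((n + 1 : ℕ) + 1 : ℝ) * θ - θ := by push_cast; ring
      rw [h1, h2, Real.sin_add, Real.sin_sub]; ring
    rw [e, ← ih1, ← ih2]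
    have h3 : (4 * Real.cos θ ^ 2)⁻¹ * (2 * Real.cos θ) ^ 2 = 1 := by
      field_simp; norm_num
    rw [show n.succ.succ = n + 2 from rfl, pow_add _ n 2, pow_succ (2 * Real.cos θ) n]
    linear_combination (-(eval (-(4 * Real.cos θ ^ 2)⁻¹) (fibPoly n)) *
      (2 * Real.cos θ) ^ n * Real.sin θ) * h3

/-- The numbers `4 cos² (π (i + 1) / (n + 1))`. -/
noncomputable def fibRoot (n : ℕ) (i : Fin (n / 2)) : ℝ :=
  4 * Real.cos (Real.pi * (i + 1) / (n + 1)) ^ 2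

/-- Below `π / 2` the cosine is positive and injective, so the `n / 2` zeros are well defined and
distinct. -/
lemma fibRoot_angle_mem (n : ℕ) (i : Fin (n / 2)) :
    Real.pi * (i + 1) / (n + 1) ∈ Set.Ioo 0 (Real.pi / 2) := by
  have hi : ((i : ℕ) + 1) * 2 < n + 1 := by have := i.2; omega
  have hi' : ((i : ℝ) + 1) * 2 < n + 1 := by exact_mod_cast hi
  have hπ := Real.pi_pos
  refine ⟨by positivity, ?_⟩
  rw [div_lt_div_iff₀ (by positivity) (by norm_num)]
  nlinarith

lemma fibRoot_cos_pos (n : ℕ) (i : Fin (n / 2)) :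
    0 < Real.cos (Real.pi * (i + 1) / (n + 1)) := by
  have h := fibRoot_angle_mem n i
  exact Real.cos_pos_of_mem_Ioo ⟨by linarith [h.1, Real.pi_pos], h.2⟩

lemma fibRoot_pos (n : ℕ) (i : Fin (n / 2)) : 0 < fibRoot n i := by
  have := fibRoot_cos_pos n i
  unfold fibRoot; positivity

lemma fibRoot_le (n : ℕ) (i : Fin (n / 2)) : fibRoot n i ≤ 4 := by
  unfold fibRoot; nlinarith [Real.cos_sq_le_one (Real.pi * (i + 1) / (n + 1))]

lemma fibRoot_injective (n : ℕ) : Function.Injective (fibRoot n) := by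
  intro i j h
  have hi := fibRoot_angle_mem n i
  have hj := fibRoot_angle_mem n j
  have h1 : Real.cos (Real.pi * (i + 1) / (n + 1)) = Real.cos (Real.pi * (j + 1) / (n + 1)) := by
    unfold fibRoot at h
    exact (pow_left_inj₀ (fibRoot_cos_pos n i).le (fibRoot_cos_pos n j).le two_ne_zero).1
      (by linarith)
  have h2 := Real.injOn_cos ⟨hi.1.le, by linarith [hi.2, Real.pi_pos]⟩
    ⟨hj.1.le, by linarith [hj.2, Real.pi_pos]⟩ h1
  have h3 : (i : ℝ) = j := by
    have := Real.pi_pos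
    field_simp at h2
    linarith
  exact Fin.ext (by exact_mod_cast h3)

open Polynomial in
lemma fibPoly_eval_fibRoot (n : ℕ) (i : Fin (n / 2)) :
    (fibPoly n).eval (-(fibRoot n i)⁻¹) = 0 := by
  have hc := (fibRoot_cos_pos n i).ne'
  have h := fibPoly_eval_cos n _ hc
  have hm := fibRoot_angle_mem n i
  have hs : Real.sin (Real.pi * (i + 1) / (n + 1)) ≠ 0 :=
    (Real.sin_pos_of_pos_of_lt_pi hm.1 (by linarith [hm.2, Real.pi_pos])).ne'
  have h0 : Real.sin (((n : ℝ) + 1) * (Real.pi * (i + 1) / (n + 1))) = 0 := by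
    have : ((n : ℝ) + 1) * (Real.pi * (i + 1) / (n + 1)) = ((i + 1 : ℕ) : ℝ) * Real.pi := by
      push_cast; field_simp
    rw [this, Real.sin_nat_mul_pi]
  rw [h0] at h
  have h2 : (2 * Real.cos (Real.pi * (i + 1) / (n + 1))) ^ n ≠ 0 := by positivity
  simpa [hs, h2, hc, fibRoot] using h

open Polynomial in
lemma fibPoly_coeff_zero (n : ℕ) : (fibPoly n).coeff 0 = 1 := by
  induction n using fibPoly.induct with
  | case1 => simp [fibPoly]
  | case2 => simp [fibPoly]
  | case3 n ih1 ih2 => simp [fibPoly, ih1]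

open Polynomial in
lemma fibPoly_coeff_one (n : ℕ) : (fibPoly (n + 1)).coeff 1 = n := by
  induction n with
  | zero => simp [fibPoly, coeff_one]
  | succ n ih => simp [fibPoly, ih, coeff_X_mul, fibPoly_coeff_zero]

open Polynomial in
lemma fibPoly_coeff_two (n : ℕ) : 2 * (fibPoly (n + 2)).coeff 2 = n * (n - 1) := by
  induction n with
  | zero => simp [fibPoly, coeff_one, coeff_X]
  | succ n ih =>
    rw [fibPoly, coeff_add, coeff_X_mul, fibPoly_coeff_one, mul_add, ih]
    push_cast; ring

open Polynomial in
/-- The Fibonacci-type polynomials have only real (negative) zeros. -/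
lemma fibPoly_eq_prod (n : ℕ) : fibPoly n = ∏ i, (1 + C (fibRoot n i) * X) := by
  classical
  -- Both sides have degree at most `n / 2`. The zeros supply `n / 2` points of agreement, and `0`
  -- is the one still needed, fixing the leading constant.
  let s : Finset ℝ := insert 0 (Finset.univ.image fun i => -(fibRoot n i)⁻¹)
  have hs : s.card = n / 2 + 1 := by
    rw [Finset.card_insert_of_notMem, Finset.card_image_of_injective]
    · simp
    · intro i j h
      exact fibRoot_injective n (inv_injective (neg_injective h))
    · simp [(fibRoot_pos n _).ne']
  refine eq_of_natDegree_lt_card_of_eval_eq' _ _ s ?_ ?_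
  · intro x hx
    rcases Finset.mem_insert.1 hx with rfl | hx
    · rw [← coeff_zero_eq_eval_zero, fibPoly_coeff_zero]
      simp [eval_prod]
    · obtain ⟨i, -, rfl⟩ := Finset.mem_image.1 hx
      rw [fibPoly_eval_fibRoot, eval_prod, Finset.prod_eq_zero (Finset.mem_univ i)]
      simp [(fibRoot_pos n i).ne']
  · rw [hs, Nat.lt_succ_iff]
    refine max_le (fibPoly_natDegree_le n) ((natDegree_prod_le _ _).trans ?_)
    refine (Finset.sum_le_card_nsmul _ _ 1 fun i _ => ?_).trans (by simp)
    compute_degree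

-- Newton's identity `2 e₂ = p₁ ^ 2 - p₂` makes the power sums of the `fibRoot` readable from
-- coefficients, without trigonometric sums.
open Polynomial in
lemma coeff_prod_one_add_C_mul_X {ι : Type*} (s : Finset ι) (c : ι → ℝ) :
    (∏ i ∈ s, (1 + C (c i) * X)).coeff 0 = 1 ∧
    (∏ i ∈ s, (1 + C (c i) * X)).coeff 1 = ∑ i ∈ s, c i ∧
    2 * (∏ i ∈ s, (1 + C (c i) * X)).coeff 2 = (∑ i ∈ s, c i) ^ 2 - ∑ i ∈ s, c i ^ 2 := by
  classical
  induction s using Finset.induction_on with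
  | empty => simp [coeff_one]
  | insert a s ha ih =>
    obtain ⟨h0, h1, h2⟩ := ih
    rw [Finset.prod_insert ha, Finset.sum_insert ha, Finset.sum_insert ha]
    simp only [add_mul, one_mul, mul_assoc, coeff_add, coeff_C_mul, coeff_X_mul,
      mul_coeff_zero, coeff_X_zero, h0, h1]
    refine ⟨by simp, by ring, by linear_combination h2⟩

lemma sum_fibRoot (n : ℕ) : ∑ i, fibRoot (n + 1) i = n := by
  rw [← (coeff_prod_one_add_C_mul_X Finset.univ (fibRoot (n + 1))).2.1, ← fibPoly_eq_prod,
    fibPoly_coeff_one]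

/-- The value is `n ^ 2 - (n - 1) (n - 2)`. It is the source of the denominator in `binN`. -/
lemma sum_fibRoot_sq (n : ℕ) (hn : 1 ≤ n) :
    ∑ i, fibRoot (n + 1) i ^ 2 = 3 * n - 2 := by
  obtain ⟨m, rfl⟩ := Nat.exists_eq_add_of_le' hn
  have h := (coeff_prod_one_add_C_mul_X Finset.univ (fibRoot (m + 1 + 1))).2.2
  rw [← fibPoly_eq_prod, fibPoly_coeff_two, sum_fibRoot] at h
  push_cast at h ⊢
  linear_combination h

/-! ### Fourier inversion and a local limit theorem for Poisson binomial laws -/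

open Polynomial in
/-- The probability generating polynomial of a sum of independent Bernoulli variables with
success probabilities `a i`. -/
noncomputable def poissonBinomialPoly {ι : Type*} [Fintype ι] (a : ι → ℝ) : Polynomial ℝ :=
  ∏ i, (1 + C (a i) * (X - 1))

lemma integral_exp_int_mul_I (j : ℤ) :
    ∫ θ in (-Real.pi)..Real.pi, Complex.exp (j * θ * Complex.I) =
      if j = 0 then 2 * (Real.pi : ℂ) else 0 := by
  split_ifs with h
  · subst h; simp; ring
  · have hc : (j * Complex.I : ℂ) ≠ 0 := by simp [h]
    have := integral_exp_mul_complex (a := -Real.pi) (b := Real.pi) hc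
    have e : ∀ θ : ℝ, (j * θ * Complex.I : ℂ) = j * Complex.I * θ := fun θ => by ring
    simp_rw [e]
    rw [this, div_eq_zero_iff]
    left
    rw [sub_eq_zero, Complex.exp_eq_exp_iff_exists_int]
    exact ⟨j, by push_cast; ring⟩

open Polynomial in
lemma integral_aeval_exp_mul_exp (Q : Polynomial ℝ) (k : ℕ) :
    ∫ θ in (-Real.pi)..Real.pi,
      aeval (Complex.exp (θ * Complex.I)) Q * Complex.exp (-(k * θ * Complex.I)) =
      2 * Real.pi * Q.coeff k := by
  have hcont : ∀ Q : Polynomial ℝ, Continuous fun θ : ℝ =>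
      aeval (Complex.exp (θ * Complex.I)) Q * Complex.exp (-(k * θ * Complex.I)) := by
    intro Q
    have := Q.continuous_aeval (A := ℂ)
    fun_prop
  induction Q using Polynomial.induction_on' with
  | add f g hf hg =>
    simp only [map_add, add_mul, coeff_add, Complex.ofReal_add, mul_add]
    rw [intervalIntegral.integral_add ((hcont f).intervalIntegrable _ _)
      ((hcont g).intervalIntegrable _ _), hf, hg]
  | monomial j c =>
    have e : ∀ θ : ℝ, aeval (Complex.exp (θ * Complex.I)) (monomial j c) *
        Complex.exp (-(k * θ * Complex.I)) =
        c * Complex.exp (((j - k : ℤ) : ℂ) * θ * Complex.I) := by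
      intro θ
      rw [aeval_monomial, ← Complex.exp_nat_mul, mul_assoc, ← Complex.exp_add]
      simp only [Complex.coe_algebraMap]
      congr 2
      push_cast; ring
    simp_rw [e]
    rw [intervalIntegral.integral_const_mul, integral_exp_int_mul_I, coeff_monomial]
    by_cases h : j = k
    · simp [h]; ring
    · have : (j - k : ℤ) ≠ 0 := by omega
      simp [h, this]

/-- The squared modulus is `1 - 2 a (1 - a) (1 - cos θ)`, while `1 - a ≥ 1 / 2` and `1 - cos θ ≥ 2 θ
^ 2 / π ^ 2` on the whole period. No separate treatment of large `θ` is needed. -/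
lemma norm_one_add_mul_exp_sub_one_le {a θ : ℝ} (h0 : 0 ≤ a) (h1 : a ≤ 1 / 2)
    (hθ : |θ| ≤ Real.pi) :
    ‖1 + (a : ℂ) * (Complex.exp (θ * Complex.I) - 1)‖ ≤ Real.exp (-(a * θ ^ 2 / Real.pi ^ 2)) := by
  have hπ := Real.pi_pos
  have hcos := Real.cos_le_one_sub_mul_cos_sq hθ
  have hsq : ‖1 + (a : ℂ) * (Complex.exp (θ * Complex.I) - 1)‖ ^ 2 =
      1 - 2 * a * (1 - a) * (1 - Real.cos θ) := by
    rw [← Complex.normSq_eq_norm_sq, Complex.normSq_apply]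
    simp only [Complex.add_re, Complex.one_re, Complex.re_ofReal_mul, Complex.sub_re,
      Complex.exp_ofReal_mul_I_re, Complex.add_im, Complex.one_im, Complex.im_ofReal_mul,
      Complex.sub_im, Complex.exp_ofReal_mul_I_im]
    linear_combination a ^ 2 * Real.sin_sq_add_cos_sq θ
  refine le_of_sq_le_sq ?_ (Real.exp_pos _).le
  rw [hsq, ← Real.exp_nat_mul]
  have h2 : a * θ ^ 2 / Real.pi ^ 2 * 2 ≤ 2 * a * (1 - a) * (1 - Real.cos θ) := by
    have h3 : a * (2 / Real.pi ^ 2 * θ ^ 2) ≤ a * (1 - Real.cos θ) := by gcongr; linarith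
    have h4 : 0 ≤ a * (1 - Real.cos θ) := mul_nonneg h0 (by linarith [Real.cos_le_one θ])
    have h5 : a * θ ^ 2 / Real.pi ^ 2 * 2 = a * (2 / Real.pi ^ 2 * θ ^ 2) := by ring
    nlinarith
  have h6 := Real.add_one_le_exp (((2 : ℕ) : ℝ) * -(a * θ ^ 2 / Real.pi ^ 2))
  push_cast at h6 ⊢
  linarith

lemma norm_prod_sub_prod_le_sum {ι : Type*} (s : Finset ι) (f g : ι → ℂ)
    (hf : ∀ i ∈ s, ‖f i‖ ≤ 1) (hg : ∀ i ∈ s, ‖g i‖ ≤ 1) :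
    ‖∏ i ∈ s, f i - ∏ i ∈ s, g i‖ ≤ ∑ i ∈ s, ‖f i - g i‖ := by
  classical
  induction s using Finset.induction_on with
  | empty => simp
  | insert a s ha ih =>
    rw [Finset.prod_insert ha, Finset.prod_insert ha, Finset.sum_insert ha]
    have e : f a * ∏ i ∈ s, f i - g a * ∏ i ∈ s, g i =
        (f a - g a) * ∏ i ∈ s, f i + g a * (∏ i ∈ s, f i - ∏ i ∈ s, g i) := by ring
    rw [e]
    refine (norm_add_le _ _).trans ?_
    rw [norm_mul, norm_mul]
    have h1 : ‖∏ i ∈ s, f i‖ ≤ 1 := by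
      rw [norm_prod]
      exact Finset.prod_le_one (fun _ _ => norm_nonneg _)
        fun i hi => hf i (Finset.mem_insert_of_mem hi)
    have h2 := ih (fun i hi => hf i (Finset.mem_insert_of_mem hi))
      (fun i hi => hg i (Finset.mem_insert_of_mem hi))
    have h3 := hg a (Finset.mem_insert_self _ _)
    have h4 : ‖g a‖ * ‖∏ i ∈ s, f i - ∏ i ∈ s, g i‖ ≤ 1 * ∑ i ∈ s, ‖f i - g i‖ := by gcongr
    have h5 : ‖f a - g a‖ * ‖∏ i ∈ s, f i‖ ≤ ‖f a - g a‖ * 1 := by gcongr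
    linarith

/-- Poisson approximation of the characteristic function of a sum of Bernoulli variables. -/
lemma norm_prod_sub_exp_le {ι : Type*} [Fintype ι] {a : ι → ℝ} {ε θ : ℝ}
    (h0 : ∀ i, 0 ≤ a i ∧ a i ≤ ε) (hε : ε ≤ 1 / 2) :
    ‖∏ i, (1 + (a i : ℂ) * (Complex.exp (θ * Complex.I) - 1)) -
      Complex.exp ((∑ i, a i : ℝ) * (Complex.exp (θ * Complex.I) - 1))‖ ≤
      ε * θ ^ 2 * ∑ i, a i := by
  set z := Complex.exp (θ * Complex.I) - 1 with hz
  have hz1 : ‖z‖ ≤ |θ| := by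
    have := Real.norm_exp_I_mul_ofReal_sub_one_le (x := θ)
    rwa [mul_comm, Real.norm_eq_abs] at this
  have hz2 : ‖z‖ ≤ 2 := by
    refine (norm_sub_le _ _).trans ?_
    rw [Complex.norm_exp_ofReal_mul_I]; norm_num
  have hre : z.re ≤ 0 := by
    rw [hz, Complex.sub_re, Complex.exp_ofReal_mul_I_re, Complex.one_re]
    linarith [Real.cos_le_one θ]
  rw [show ((∑ i, a i : ℝ) : ℂ) * z = ∑ i, (a i : ℂ) * z by
    push_cast; rw [Finset.sum_mul], Complex.exp_sum]
  refine (norm_prod_sub_prod_le_sum _ _ _ ?_ ?_).trans ?_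
  · intro i _
    have e : 1 + (a i : ℂ) * z = (1 - a i : ℝ) + (a i : ℂ) * Complex.exp (θ * Complex.I) := by
      rw [hz]; push_cast; ring
    rw [e]
    refine (norm_add_le _ _).trans ?_
    rw [norm_mul, Complex.norm_exp_ofReal_mul_I, Complex.norm_real, Complex.norm_real,
      Real.norm_of_nonneg (h0 i).1, Real.norm_of_nonneg (by linarith [(h0 i).2])]
    linarith
  · intro i _
    rw [Complex.norm_exp, Real.exp_le_one_iff, Complex.re_ofReal_mul]
    exact mul_nonpos_of_nonneg_of_nonpos (h0 i).1 hre
  · rw [Finset.mul_sum]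
    refine Finset.sum_le_sum fun i _ => ?_
    have hn : ‖(a i : ℂ) * z‖ = a i * ‖z‖ := by
      rw [norm_mul, Complex.norm_real, Real.norm_of_nonneg (h0 i).1]
    -- The estimate requires `‖a i * z‖ ≤ 1`, which follows from `a i ≤ 1 / 2` and `‖z‖ ≤ 2`.
    have hb := Complex.norm_exp_sub_one_sub_id_le (x := (a i : ℂ) * z) (by
      rw [hn]; nlinarith [(h0 i).1, (h0 i).2, norm_nonneg z])
    rw [← norm_neg, show -(1 + (a i : ℂ) * z - Complex.exp ((a i : ℂ) * z)) =
      Complex.exp ((a i : ℂ) * z) - 1 - (a i : ℂ) * z by ring]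
    refine hb.trans ?_
    rw [hn, mul_pow, sq (a i)]
    have h1 : ‖z‖ ^ 2 ≤ θ ^ 2 := by
      rw [← sq_abs θ]; gcongr
    have h2 : a i * a i ≤ ε * a i := by gcongr; exacts [(h0 i).1, (h0 i).2]
    have h3 : 0 ≤ ε * a i := by have := h0 i; exact mul_nonneg (this.1.trans this.2) this.1
    calc a i * a i * ‖z‖ ^ 2 ≤ ε * a i * θ ^ 2 := by gcongr
      _ = _ := by ring

lemma norm_exp_mul_I_sub_quadratic_le {θ : ℝ} (hθ : |θ| ≤ 1) :
    ‖Complex.exp (θ * Complex.I) - 1 - θ * Complex.I + θ ^ 2 / 2‖ ≤ |θ| ^ 3 := by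
  have hn : ‖(θ * Complex.I : ℂ)‖ = |θ| := by simp
  have h := Complex.exp_bound (x := θ * Complex.I) (by rw [hn]; exact hθ) (n := 3) (by norm_num)
  rw [hn] at h
  have e : ∑ m ∈ Finset.range 3, (θ * Complex.I : ℂ) ^ m / (m.factorial : ℂ) =
      1 + θ * Complex.I - θ ^ 2 / 2 := by
    simp [Finset.sum_range_succ, mul_pow, Nat.factorial]; ring
  rw [e] at h
  rw [show Complex.exp (θ * Complex.I) - 1 - θ * Complex.I + θ ^ 2 / 2 =
    Complex.exp (θ * Complex.I) - (1 + θ * Complex.I - θ ^ 2 / 2) by ring]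
  refine h.trans (mul_le_of_le_one_right (by positivity) ?_)
  norm_num [Nat.factorial]

open Polynomial in
lemma aeval_poissonBinomialPoly {ι : Type*} [Fintype ι] (a : ι → ℝ) (z : ℂ) :
    aeval z (poissonBinomialPoly a) = ∏ i, (1 + (a i : ℂ) * (z - 1)) := by
  simp [poissonBinomialPoly, map_prod]

/-- The characteristic function of the centred and rescaled Poisson binomial law. -/
noncomputable def scaledCharFun {ι : Type*} [Fintype ι] (a : ι → ℝ) (m : ℝ) (k : ℕ) (u : ℝ) : ℂ :=
  (∏ i, (1 + (a i : ℂ) * (Complex.exp ((u / √m : ℝ) * Complex.I) - 1))) *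
    Complex.exp (-(k * (u / √m : ℝ) * Complex.I))

lemma continuous_scaledCharFun {ι : Type*} [Fintype ι] (a : ι → ℝ) (m : ℝ) (k : ℕ) :
    Continuous (scaledCharFun a m k) := by
  unfold scaledCharFun; fun_prop

lemma integral_scaledCharFun {ι : Type*} [Fintype ι] (a : ι → ℝ) {m : ℝ} (hm : 0 < m) (k : ℕ) :
    ∫ u in Set.Ioc (-(Real.pi * √m)) (Real.pi * √m), scaledCharFun a m k u =
      2 * Real.pi * ((√m * (poissonBinomialPoly a).coeff k : ℝ) : ℂ) := by
  have hs : 0 < √m := Real.sqrt_pos.2 hm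
  have hπ := Real.pi_pos
  rw [← intervalIntegral.integral_of_le (by nlinarith [mul_pos hπ hs])]
  have h := intervalIntegral.integral_comp_div (a := -(Real.pi * √m)) (b := Real.pi * √m)
    (fun θ : ℝ => (∏ i, (1 + (a i : ℂ) * (Complex.exp (θ * Complex.I) - 1))) *
      Complex.exp (-(k * θ * Complex.I))) hs.ne'
  have e : -(Real.pi * √m) / √m = -Real.pi := by field_simp
  have e' : Real.pi * √m / √m = Real.pi := by field_simp
  rw [e, e'] at h
  have h2 := integral_aeval_exp_mul_exp (poissonBinomialPoly a) k
  simp_rw [aeval_poissonBinomialPoly] at h2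
  rw [h2] at h
  unfold scaledCharFun
  rw [h, Complex.real_smul]
  push_cast; ring

/-- The Gaussian bound does not depend on `a`, `m` or `k`, so it serves as the dominating function
in the local limit theorem. -/
lemma norm_scaledCharFun_le {ι : Type*} [Fintype ι] {a : ι → ℝ} {m : ℝ} (hm : 0 < m) (k : ℕ)
    (h0 : ∀ i, 0 ≤ a i ∧ a i ≤ 1 / 2) (hsum : m / 2 ≤ ∑ i, a i) {u : ℝ}
    (hu : |u| ≤ Real.pi * √m) :
    ‖scaledCharFun a m k u‖ ≤ Real.exp (-(1 / (2 * Real.pi ^ 2)) * u ^ 2) := by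
  have hs : 0 < √m := Real.sqrt_pos.2 hm
  have hπ := Real.pi_pos
  have hk : ‖Complex.exp (-(k * (u / √m : ℝ) * Complex.I))‖ = 1 := by
    rw [Complex.norm_exp]; simp
  have hθ : |u / √m| ≤ Real.pi := by
    rw [abs_div, abs_of_pos hs, div_le_iff₀ hs]; exact hu
  rw [scaledCharFun, norm_mul, hk, mul_one, norm_prod]
  refine (Finset.prod_le_prod (fun _ _ => norm_nonneg _) fun i _ =>
    norm_one_add_mul_exp_sub_one_le (h0 i).1 (h0 i).2 hθ).trans ?_
  rw [← Real.exp_sum, Real.exp_le_exp, Finset.sum_neg_distrib, neg_mul, neg_le_neg_iff,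
    ← Finset.sum_div, ← Finset.sum_mul, div_pow, Real.sq_sqrt hm.le]
  have h1 : 1 / (2 * Real.pi ^ 2) * u ^ 2 = m / 2 * (u ^ 2 / m) / Real.pi ^ 2 := by
    field_simp
  rw [h1]
  gcongr

/-- With `μ = ∑ a` and `θ = u / √m`, replacing the law by a Poisson law of mean `μ` costs at most `ε
μ θ ^ 2 → 0`. The remaining exponent is `i (μ - k) θ - μ θ ^ 2 / 2 + O(μ |θ| ^ 3)`. Its first term
vanishes since `μ` and `k` are both `m + o(√m)`. -/
lemma tendsto_scaledCharFun {ι : ℕ → Type} [∀ n, Fintype (ι n)] {a : ∀ n, ι n → ℝ}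
    {ε m : ℕ → ℝ} {k : ℕ → ℕ} (h0 : ∀ᶠ n in atTop, ∀ i, 0 ≤ a n i ∧ a n i ≤ ε n)
    (hε : Tendsto ε atTop (𝓝 0)) (hm : Tendsto m atTop atTop)
    (hμ : Tendsto (fun n => (∑ i, a n i - m n) / √(m n)) atTop (𝓝 0))
    (hk : Tendsto (fun n => ((k n : ℝ) - m n) / √(m n)) atTop (𝓝 0)) (u : ℝ) :
    Tendsto (fun n => scaledCharFun (a n) (m n) (k n) u) atTop
      (𝓝 (Complex.exp (-(1 / 2 : ℂ) * u ^ 2))) := by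
  set μ : ℕ → ℝ := fun n => ∑ i, a n i with hμdef
  set θ : ℕ → ℝ := fun n => u / √(m n) with hθdef
  have hsq : Tendsto (fun n => √(m n)) atTop atTop := Real.tendsto_sqrt_atTop.comp hm
  have hθ0 : Tendsto θ atTop (𝓝 0) := hsq.const_div_atTop u
  have hm0 : ∀ᶠ n in atTop, 0 < m n := hm.eventually_gt_atTop 0
  have hμm : Tendsto (fun n => μ n / m n) atTop (𝓝 1) := by
    have h1 : Tendsto (fun n => (μ n - m n) / √(m n) * (√(m n))⁻¹ + 1) atTop (𝓝 (0 * 0 + 1)) :=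
      (hμ.mul hsq.inv_tendsto_atTop).add_const 1
    simp only [mul_zero, zero_add] at h1
    refine h1.congr' ?_
    filter_upwards [hm0] with n hn
    have := Real.sqrt_pos.2 hn
    rw [← div_eq_mul_inv, div_div, Real.mul_self_sqrt hn.le]
    field_simp; ring
  have hμθ : Tendsto (fun n => μ n * θ n ^ 2) atTop (𝓝 (u ^ 2)) := by
    have h1 := hμm.mul_const (u ^ 2)
    rw [one_mul] at h1
    refine h1.congr' ?_
    filter_upwards [hm0] with n hn
    rw [hθdef]; simp only
    rw [div_pow, Real.sq_sqrt hn.le]; ring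
  have hdiff : Tendsto (fun n => scaledCharFun (a n) (m n) (k n) u -
      Complex.exp ((μ n : ℝ) * (Complex.exp (θ n * Complex.I) - 1) - k n * θ n * Complex.I))
      atTop (𝓝 0) := by
    have hb : Tendsto (fun n => ε n * (μ n * θ n ^ 2)) atTop (𝓝 0) := by
      simpa using hε.mul hμθ
    refine squeeze_zero_norm' ?_ hb
    filter_upwards [h0, hε.eventually_le_const (show (0 : ℝ) < 1 / 2 by norm_num)] with n hn hn'
    have hb := norm_prod_sub_exp_le (θ := θ n) hn hn'
    rw [scaledCharFun, sub_eq_add_neg (_ * _) (_ * Complex.I), Complex.exp_add, ← sub_mul,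
      norm_mul]
    have hk1 : ‖Complex.exp (-(k n * θ n * Complex.I))‖ = 1 := by
      rw [Complex.norm_exp]; simp
    rw [hk1, mul_one]
    refine hb.trans (le_of_eq ?_)
    simp only [hμdef]; ring
  have hexp : Tendsto (fun n => (μ n : ℂ) * (Complex.exp (θ n * Complex.I) - 1) -
      k n * θ n * Complex.I) atTop (𝓝 (-(1 / 2 : ℂ) * u ^ 2)) := by
    have hrem : Tendsto (fun n => (μ n : ℂ) *
        (Complex.exp (θ n * Complex.I) - 1 - θ n * Complex.I + θ n ^ 2 / 2)) atTop (𝓝 0) := by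
      have hb : Tendsto (fun n => |μ n * θ n ^ 2| * |θ n|) atTop (𝓝 0) := by
        simpa using hμθ.abs.mul hθ0.abs
      refine squeeze_zero_norm' ?_ hb
      filter_upwards [hθ0.abs.eventually_le_const (show |(0 : ℝ)| < 1 by norm_num)] with n hn
      rw [norm_mul, Complex.norm_real, Real.norm_eq_abs]
      refine (mul_le_mul_of_nonneg_left (norm_exp_mul_I_sub_quadratic_le hn)
        (abs_nonneg _)).trans (le_of_eq ?_)
      rw [abs_mul, abs_pow]; ring
    have hmean : Tendsto (fun n => (((μ n - m n) / √(m n) - ((k n : ℝ) - m n) / √(m n)) * u : ℝ))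
        atTop (𝓝 0) := by
      simpa using (hμ.sub hk).mul_const u
    have hmain := (hrem.sub ((Complex.continuous_ofReal.tendsto _).comp
      (hμθ.div_const 2))).add (((Complex.continuous_ofReal.tendsto _).comp hmean).mul_const
      Complex.I)
    have hval : (0 : ℂ) - ((u ^ 2 / 2 : ℝ) : ℂ) + ((0 : ℝ) : ℂ) * Complex.I =
        -(1 / 2 : ℂ) * u ^ 2 := by push_cast; ring
    rw [hval] at hmain
    refine hmain.congr fun n => ?_
    have e : ((μ n - m n) / √(m n) - ((k n : ℝ) - m n) / √(m n)) * u = μ n * θ n - k n * θ n := by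
      simp only [hθdef]; ring
    simp only [Function.comp_apply]
    rw [e]
    push_cast; ring
  have := hdiff.add ((Complex.continuous_exp.tendsto _).comp hexp)
  simpa using this

/-- A local limit theorem for Poisson binomial laws with uniformly small success
probabilities. -/
theorem tendsto_sqrt_mul_coeff_poissonBinomialPoly {ι : ℕ → Type} [∀ n, Fintype (ι n)]
    {a : ∀ n, ι n → ℝ}
    {ε m : ℕ → ℝ} {k : ℕ → ℕ} (h0 : ∀ᶠ n in atTop, ∀ i, 0 ≤ a n i ∧ a n i ≤ ε n)
    (hε : Tendsto ε atTop (𝓝 0)) (hm : Tendsto m atTop atTop)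
    (hμ : Tendsto (fun n => (∑ i, a n i - m n) / √(m n)) atTop (𝓝 0))
    (hk : Tendsto (fun n => ((k n : ℝ) - m n) / √(m n)) atTop (𝓝 0)) :
    Tendsto (fun n => √(m n) * (poissonBinomialPoly (a n)).coeff (k n)) atTop
      (𝓝 (√(2 * Real.pi) / (2 * Real.pi))) := by
  have hπ := Real.pi_pos
  have hm0 : ∀ᶠ n in atTop, 0 < m n := hm.eventually_gt_atTop 0
  have hsq : Tendsto (fun n => √(m n)) atTop atTop := Real.tendsto_sqrt_atTop.comp hm
  -- The sum is eventually at least `m - √m`, and `√m ≤ m / 2` once `√m ≥ 2`.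
  have hhalf : ∀ᶠ n in atTop, m n / 2 ≤ ∑ i, a n i := by
    filter_upwards [hm0, hsq.eventually_ge_atTop 2,
      hμ.eventually_const_le (show (-1 : ℝ) < 0 by norm_num)] with n hn h2 h1
    have hs := Real.sqrt_pos.2 hn
    rw [le_div_iff₀ hs] at h1
    nlinarith [Real.mul_self_sqrt hn.le]
  have hlim : Tendsto (fun n => ∫ u, (Set.Ioc (-(Real.pi * √(m n))) (Real.pi * √(m n))).indicator
      (scaledCharFun (a n) (m n) (k n)) u) atTop
      (𝓝 (∫ u : ℝ, Complex.exp (-(1 / 2 : ℂ) * u ^ 2))) := by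
    refine tendsto_integral_filter_of_dominated_convergence
      (fun u => Real.exp (-(1 / (2 * Real.pi ^ 2)) * u ^ 2)) ?_ ?_ ?_ ?_
    · exact Eventually.of_forall fun n =>
        (continuous_scaledCharFun _ _ _).aestronglyMeasurable.indicator measurableSet_Ioc
    · filter_upwards [h0, hm0, hhalf, hε.eventually_le_const (show (0 : ℝ) < 1 / 2 by norm_num)]
        with n h0 hn hh he
      refine Eventually.of_forall fun u => ?_
      by_cases hu : u ∈ Set.Ioc (-(Real.pi * √(m n))) (Real.pi * √(m n))
      · rw [Set.indicator_of_mem hu]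
        exact norm_scaledCharFun_le hn _ (fun i => ⟨(h0 i).1, (h0 i).2.trans he⟩) hh
          (abs_le.2 ⟨hu.1.le, hu.2⟩)
      · rw [Set.indicator_of_notMem hu, norm_zero]
        exact (Real.exp_pos _).le
    · exact integrable_exp_neg_mul_sq (by positivity)
    · refine Eventually.of_forall fun u => ?_
      refine (tendsto_scaledCharFun h0 hε hm hμ hk u).congr' ?_
      filter_upwards [(hsq.const_mul_atTop hπ).eventually_gt_atTop |u|] with n hn
      rw [Set.indicator_of_mem]
      exact ⟨(abs_lt.1 hn).1, (abs_lt.1 hn).2.le⟩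
  have hG : ∫ u : ℝ, Complex.exp (-(1 / 2 : ℂ) * u ^ 2) = ((√(2 * Real.pi) : ℝ) : ℂ) := by
    have h := integral_gaussian (1 / 2)
    rw [show Real.pi / (1 / 2) = 2 * Real.pi by ring] at h
    rw [← h, ← integral_complex_ofReal]
    congr 1; ext u; push_cast; rfl
  rw [hG] at hlim
  have hre := ((Complex.continuous_re.tendsto _).comp hlim).div_const (2 * Real.pi)
  rw [Complex.ofReal_re] at hre
  refine hre.congr' ?_
  filter_upwards [hm0] with n hn
  simp only [Function.comp_apply]
  rw [integral_indicator measurableSet_Ioc, integral_scaledCharFun _ hn]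
  rw [show (2 * Real.pi * ((√(m n) * (poissonBinomialPoly (a n)).coeff (k n) : ℝ) : ℂ)) =
    ((2 * Real.pi * (√(m n) * (poissonBinomialPoly (a n)).coeff (k n)) : ℝ) : ℂ) by
      push_cast; ring, Complex.ofReal_re]
  field_simp

/-! ### Exponential tilting and comparison of two Poisson binomial laws -/

open Polynomial in
/-- Exponential tilting of a Poisson binomial law. -/
lemma coeff_poissonBinomialPoly_tilt {ι : Type*} [Fintype ι] (a : ι → ℝ) (s : ℝ)
    (h : ∀ i, 1 + a i * s ≠ 0) (k : ℕ) :
    (poissonBinomialPoly a).coeff k * (1 + s) ^ k =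
      (∏ i, (1 + a i * s)) *
        (poissonBinomialPoly fun i => a i * (1 + s) / (1 + a i * s)).coeff k := by
  -- The factor `(1 + s) ^ k` amounts to substituting `(1 + s) X` for `X`, after which the identity
  -- holds factor by factor.
  rw [← comp_C_mul_X_coeff, ← coeff_C_mul]
  congr 1
  simp only [poissonBinomialPoly, prod_comp, map_prod, ← Finset.prod_mul_distrib]
  refine Finset.prod_congr rfl fun i _ => ?_
  have h1 : (1 + a i * s) * (a i * (1 + s) / (1 + a i * s)) = a i * (1 + s) := by
    field_simp [h i]
  have h2 : (C (1 + a i * s) : Polynomial ℝ) * C (a i * (1 + s) / (1 + a i * s)) =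
      C (a i) * C (1 + s) := by rw [← C_mul, h1, C_mul]
  simp only [add_comp, one_comp, mul_comp, C_comp, sub_comp, X_comp]
  have h3 : (C (1 + a i * s) : Polynomial ℝ) = 1 + C (a i) * (C (1 + s) - 1) := by
    simp
  linear_combination (1 - X) * h2 - h3

/-- Second-order Taylor expansion of each logarithm: the remainder is at most `|a s| ^ 3 / (1 - |a
s|) ≤ 2 |a s| ^ 3`, and `a ^ 3 ≤ c a ^ 2`. -/
lemma abs_log_prod_sub_le {ι : Type*} [Fintype ι] {a : ι → ℝ} {c s : ℝ}
    (h0 : ∀ i, 0 ≤ a i ∧ a i ≤ c) (hc : c ≤ 1 / 2) (hs : |s| ≤ 1 / 2) :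
    |Real.log (∏ i, (1 + a i * s)) - (s * ∑ i, a i - s ^ 2 / 2 * ∑ i, a i ^ 2)| ≤
      2 * |s| ^ 3 * c * ∑ i, a i ^ 2 := by
  have hle : ∀ i, |a i * s| ≤ 1 / 2 := by
    intro i
    rw [abs_mul, abs_of_nonneg (h0 i).1]
    nlinarith [abs_nonneg s, (h0 i).1, (h0 i).2]
  rw [Real.log_prod fun i _ => by have := abs_le.1 (hle i); linarith, Finset.mul_sum,
    Finset.mul_sum, ← Finset.sum_sub_distrib, ← Finset.sum_sub_distrib, Finset.mul_sum]
  refine (Finset.abs_sum_le_sum_abs _ _).trans (Finset.sum_le_sum fun i _ => ?_)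
  have h := Real.abs_log_sub_add_sum_range_le (x := -(a i * s))
    (by rw [abs_neg]; linarith [hle i]) 2
  rw [abs_neg] at h
  simp only [Finset.sum_range_succ, Finset.range_zero, Finset.sum_empty] at h
  norm_num at h
  have e : Real.log (1 + a i * s) - (s * a i - s ^ 2 / 2 * a i ^ 2) =
      -(a i * s) + (a i * s) ^ 2 / 2 + Real.log (1 + a i * s) := by ring
  rw [e]
  refine h.trans ?_
  rw [← abs_mul, div_le_iff₀ (by linarith [hle i])]
  have h3 : |a i * s| ^ 3 ≤ |s| ^ 3 * c * a i ^ 2 := by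
    rw [abs_mul, abs_of_nonneg (h0 i).1]
    have : a i ^ 3 ≤ c * a i ^ 2 := by
      rw [pow_succ, mul_comm]; gcongr; exact (h0 i).2
    calc (a i * |s|) ^ 3 = |s| ^ 3 * a i ^ 3 := by ring
      _ ≤ |s| ^ 3 * (c * a i ^ 2) := by gcongr
      _ = _ := by ring
  have h4 : 0 ≤ |a i * s| ^ 3 := by positivity
  nlinarith [hle i]

/-- Each summand has the exact remainder `(1 + s) s ^ 2 a ^ 3 / (1 + a s)`, where `(1 + s) / (1 + a
s) ≤ 3`. -/
lemma abs_tilted_mean_sub_le {ι : Type*} [Fintype ι] {a : ι → ℝ} {c s : ℝ}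
    (h0 : ∀ i, 0 ≤ a i ∧ a i ≤ c) (hc : c ≤ 1 / 2) (hs : |s| ≤ 1 / 2) :
    |∑ i, a i * (1 + s) / (1 + a i * s) - (1 + s) * (∑ i, a i - s * ∑ i, a i ^ 2)| ≤
      4 * s ^ 2 * c * ∑ i, a i ^ 2 := by
  rw [Finset.mul_sum, ← Finset.sum_sub_distrib, Finset.mul_sum, ← Finset.sum_sub_distrib,
    Finset.mul_sum]
  refine (Finset.abs_sum_le_sum_abs _ _).trans (Finset.sum_le_sum fun i _ => ?_)
  obtain ⟨h1, h2⟩ := h0 i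
  obtain ⟨h3, h4⟩ := abs_le.1 hs
  have h5 : 1 / 2 ≤ 1 + a i * s := by nlinarith
  have e : a i * (1 + s) / (1 + a i * s) - (1 + s) * (a i - s * a i ^ 2) =
      (1 + s) * (s ^ 2 * a i ^ 3) / (1 + a i * s) := by
    field_simp; ring
  rw [e, abs_of_nonneg (by apply div_nonneg <;> [apply mul_nonneg; skip] <;> first | positivity | linarith),
    div_le_iff₀ (by linarith)]
  have h6 : s ^ 2 * a i ^ 3 ≤ s ^ 2 * c * a i ^ 2 := by
    calc s ^ 2 * a i ^ 3 = s ^ 2 * (a i * a i ^ 2) := by ring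
      _ ≤ s ^ 2 * (c * a i ^ 2) := by gcongr
      _ = _ := by ring
  have h7 : 0 ≤ s ^ 2 * a i ^ 3 := by positivity
  nlinarith

/-- Two Poisson binomial laws with equal means and nearly equal variances have asymptotically
equal point probabilities in a range of moderate deviations described by the tilt `s`. -/
theorem tendsto_coeff_div_coeff_poissonBinomialPoly {ι κ : ℕ → Type} [∀ n, Fintype (ι n)]
    [∀ n, Fintype (κ n)] {a : ∀ n, ι n → ℝ} {b : ∀ n, κ n → ℝ} {c Q D s : ℕ → ℝ} {x : ℕ → ℕ}
    (ha : ∀ᶠ n in atTop, ∀ i, 0 ≤ a n i ∧ a n i ≤ c n)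
    (hb : ∀ᶠ n in atTop, ∀ i, 0 ≤ b n i ∧ b n i ≤ c n)
    (hsum : ∀ᶠ n in atTop, ∑ i, a n i = ∑ i, b n i)
    (haQ : ∀ᶠ n in atTop, ∑ i, a n i ^ 2 ≤ Q n) (hbQ : ∀ᶠ n in atTop, ∑ i, b n i ^ 2 ≤ Q n)
    (habD : ∀ᶠ n in atTop, |∑ i, a n i ^ 2 - ∑ i, b n i ^ 2| ≤ D n)
    (hx : ∀ᶠ n in atTop, ∑ i, b n i * (1 + s n) / (1 + b n i * s n) = x n)
    (hxtop : Tendsto x atTop atTop)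
    (hc : Tendsto c atTop (𝓝 0)) (hs : Tendsto s atTop (𝓝 0)) (hD : Tendsto D atTop (𝓝 0))
    (hlog : Tendsto (fun n => |s n| ^ 3 * c n * Q n) atTop (𝓝 0))
    (hmean : Tendsto (fun n => s n ^ 2 * c n * Q n / √(x n)) atTop (𝓝 0)) :
    Tendsto (fun n => (poissonBinomialPoly (a n)).coeff (x n) /
      (poissonBinomialPoly (b n)).coeff (x n)) atTop (𝓝 1) := by
  have hπ := Real.pi_pos
  have hxr : Tendsto (fun n => (x n : ℝ)) atTop atTop := tendsto_natCast_atTop_atTop.comp hxtop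
  have hsqx : Tendsto (fun n => √(x n : ℝ)) atTop atTop := Real.tendsto_sqrt_atTop.comp hxr
  have hchalf := hc.eventually_le_const (show (0 : ℝ) < 1 / 2 by norm_num)
  have hshalf : ∀ᶠ n in atTop, |s n| ≤ 1 / 2 :=
    hs.abs.eventually_le_const (show |(0 : ℝ)| < 1 / 2 by norm_num)
  have h4c : Tendsto (fun n => 4 * c n) atTop (𝓝 0) := by simpa using hc.const_mul 4
  have hden : ∀ {y c s : ℝ}, 0 ≤ y ∧ y ≤ c → c ≤ 1 / 2 → |s| ≤ 1 / 2 → 1 / 2 ≤ 1 + y * s := by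
    intro y c s hy hc hs
    have := abs_le.1 hs
    nlinarith
  have htilt : ∀ {y c s : ℝ}, 0 ≤ y ∧ y ≤ c → c ≤ 1 / 2 → |s| ≤ 1 / 2 →
      0 ≤ y * (1 + s) / (1 + y * s) ∧ y * (1 + s) / (1 + y * s) ≤ 4 * c := by
    intro y c s hy hc hs
    have h1 := hden hy hc hs
    have := abs_le.1 hs
    refine ⟨div_nonneg (mul_nonneg hy.1 (by linarith)) (by linarith), ?_⟩
    rw [div_le_iff₀ (by linarith)]
    nlinarith
  have hk : Tendsto (fun n => ((x n : ℝ) - (x n : ℝ)) / √(x n : ℝ)) atTop (𝓝 0) := by simp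
  have hA := tendsto_sqrt_mul_coeff_poissonBinomialPoly
    (a := fun n i => a n i * (1 + s n) / (1 + a n i * s n)) (m := fun n => (x n : ℝ)) (k := x)
    (by filter_upwards [ha, hchalf, hshalf] with n h1 h2 h3 i using htilt (h1 i) h2 h3)
    h4c hxr (by
      -- The tilted `b` has mean exactly `x`. As the untilted means agree, the tilted means differ
      -- by `(1 + s) s` times the gap of the sums of squares, at most `2 |s| D`, plus two remainders
      -- of at most `4 s ^ 2 c Q` each.
      have hlim : Tendsto (fun n => 2 * (|s n| * D n * (√(x n : ℝ))⁻¹) +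
          8 * (s n ^ 2 * c n * Q n / √(x n))) atTop (𝓝 0) := by
        have := ((hs.abs.mul hD).mul hsqx.inv_tendsto_atTop).const_mul 2
        simpa using this.add (hmean.const_mul 8)
      refine squeeze_zero_norm' ?_ hlim
      filter_upwards [ha, hb, hchalf, hshalf, hsum, haQ, hbQ, habD, hx,
        hsqx.eventually_gt_atTop 0] with n ha hb hc2 hs2 hsum haQ hbQ hD hx hpos
      have e1 := abs_tilted_mean_sub_le ha hc2 hs2
      have e2 := abs_tilted_mean_sub_le hb hc2 hs2
      rw [hx] at e2
      rw [hsum] at e1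
      rw [Real.norm_eq_abs, abs_div, abs_of_pos hpos]
      have hrhs : 2 * (|s n| * D n * (√(x n : ℝ))⁻¹) + 8 * (s n ^ 2 * c n * Q n / √(x n)) =
          (2 * (|s n| * D n) + 8 * (s n ^ 2 * c n * Q n)) / √(x n) := by
        field_simp
      rw [hrhs]
      gcongr
      set A := ∑ i, a n i ^ 2
      set B := ∑ i, b n i ^ 2
      set M := ∑ i, b n i
      -- An index is needed only for `0 ≤ c n`. Without one the common mean is `0`, so every `b n i`
      -- is `0` and `x n = 0`, against `√(x n) > 0`.
      by_cases hι : Nonempty (ι n)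
      · obtain ⟨i⟩ := hι
        have hc0 : 0 ≤ c n := (ha i).1.trans (ha i).2
        have f1 : 4 * s n ^ 2 * c n * A ≤ 4 * (s n ^ 2 * c n * Q n) := by
          have : s n ^ 2 * c n * A ≤ s n ^ 2 * c n * Q n := by gcongr
          linarith
        have f2 : 4 * s n ^ 2 * c n * B ≤ 4 * (s n ^ 2 * c n * Q n) := by
          have : s n ^ 2 * c n * B ≤ s n ^ 2 * c n * Q n := by gcongr
          linarith
        have f3 : |(1 + s n) * (s n * (A - B))| ≤ 2 * (|s n| * D n) := by
          rw [abs_mul, abs_mul]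
          have g1 : |1 + s n| ≤ 2 := by
            rw [abs_le]; constructor <;> linarith [(abs_le.1 hs2).1, (abs_le.1 hs2).2]
          gcongr
        have g1 := abs_le.1 e1
        have g2 := abs_le.1 e2
        have g3 := abs_le.1 f3
        rw [abs_le]
        constructor <;> linarith [g1.1, g1.2, g2.1, g2.2, g3.1, g3.2]
      · exfalso
        have hι' : IsEmpty (ι n) := not_nonempty_iff.1 hι
        have hM : M = 0 := by rw [← hsum]; simp
        have hb0 : ∀ i, b n i = 0 := by
          intro i
          exact (Finset.sum_eq_zero_iff_of_nonneg fun i _ => (hb i).1).1 hM i (Finset.mem_univ i)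
        simp only [hb0, zero_mul, zero_div, Finset.sum_const_zero] at hx
        rw [← hx] at hpos
        simp at hpos) hk
  have hB := tendsto_sqrt_mul_coeff_poissonBinomialPoly
    (a := fun n i => b n i * (1 + s n) / (1 + b n i * s n)) (m := fun n => (x n : ℝ)) (k := x)
    (by filter_upwards [hb, hchalf, hshalf] with n h1 h2 h3 i using htilt (h1 i) h2 h3)
    h4c hxr (by
      refine tendsto_const_nhds.congr' ?_
      filter_upwards [hx] with n hx
      rw [hx]; simp) hk
  -- The linear terms cancel by `hsum`, the quadratic ones leave `s ^ 2 D / 2`, and each cubic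
  -- remainder is at most `2 |s| ^ 3 c Q`.
  have hl : Tendsto (fun n => Real.log (∏ i, (1 + a n i * s n)) -
      Real.log (∏ i, (1 + b n i * s n))) atTop (𝓝 0) := by
    have hlim : Tendsto (fun n => s n ^ 2 / 2 * D n + 4 * (|s n| ^ 3 * c n * Q n))
        atTop (𝓝 0) := by
      simpa using (((hs.pow 2).div_const 2).mul hD).add (hlog.const_mul 4)
    refine squeeze_zero_norm' ?_ hlim
    filter_upwards [ha, hb, hchalf, hshalf, hsum, haQ, hbQ, habD, hx,
      hsqx.eventually_gt_atTop 0] with n ha hb hc2 hs2 hsum haQ hbQ hD hx hpos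
    have e1 := abs_log_prod_sub_le ha hc2 hs2
    have e2 := abs_log_prod_sub_le hb hc2 hs2
    rw [hsum] at e1
    have hκ : Nonempty (κ n) := by
      by_contra hκ
      have : IsEmpty (κ n) := not_nonempty_iff.1 hκ
      simp only [Finset.univ_eq_empty, Finset.sum_empty] at hx
      rw [← hx] at hpos
      simp at hpos
    obtain ⟨i⟩ := hκ
    have hc0 : 0 ≤ c n := (hb i).1.trans (hb i).2
    have f1 : |s n| ^ 3 * c n * ∑ i, a n i ^ 2 ≤ |s n| ^ 3 * c n * Q n := by gcongr
    have f2 : |s n| ^ 3 * c n * ∑ i, b n i ^ 2 ≤ |s n| ^ 3 * c n * Q n := by gcongr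
    have f3 : |s n ^ 2 / 2 * (∑ i, a n i ^ 2 - ∑ i, b n i ^ 2)| ≤ s n ^ 2 / 2 * D n := by
      rw [abs_mul, abs_of_nonneg (by positivity)]; gcongr
    have g1 := abs_le.1 e1
    have g2 := abs_le.1 e2
    have g3 := abs_le.1 f3
    rw [Real.norm_eq_abs, abs_le]
    constructor <;> linarith [g1.1, g1.2, g2.1, g2.2, g3.1, g3.2]
  have hprod := (Real.continuous_exp.tendsto 0).comp hl
  rw [Real.exp_zero] at hprod
  -- Both local limits equal this constant, so only its being non-zero matters for the quotient.
  have hlimne : √(2 * Real.pi) / (2 * Real.pi) ≠ 0 := by positivity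
  have hfin := hprod.mul (hA.div hB hlimne)
  rw [div_self hlimne, mul_one] at hfin
  refine hfin.congr' ?_
  filter_upwards [ha, hb, hchalf, hshalf, hsqx.eventually_gt_atTop 0] with n ha hb hc2 hs2 hpos
  have ta := coeff_poissonBinomialPoly_tilt (a n) (s n)
    (fun i => by linarith [hden (ha i) hc2 hs2]) (x n)
  have tb := coeff_poissonBinomialPoly_tilt (b n) (s n)
    (fun i => by linarith [hden (hb i) hc2 hs2]) (x n)
  have pa : 0 < ∏ i, (1 + a n i * s n) :=
    Finset.prod_pos fun i _ => by linarith [hden (ha i) hc2 hs2]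
  have pb : 0 < ∏ i, (1 + b n i * s n) :=
    Finset.prod_pos fun i _ => by linarith [hden (hb i) hc2 hs2]
  have hz : (1 + s n) ^ x n ≠ 0 := by
    have := abs_le.1 hs2
    exact pow_ne_zero _ (by linarith)
  simp only [Function.comp_apply, Pi.div_apply]
  rw [Real.exp_sub, Real.exp_log pa, Real.exp_log pb, mul_div_mul_left _ _ hpos.ne',
    div_mul_div_comm, ← ta, ← tb, mul_div_mul_right _ _ hz]

/-! ### The descent count against the binomial law -/

open Polynomial in
lemma fibPoly_comp_eq_poissonBinomialPoly (n : ℕ) (α : ℝ) :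
    (fibPoly n).comp (C α * (X - 1)) = poissonBinomialPoly fun i => α * fibRoot n i := by
  rw [fibPoly_eq_prod, poissonBinomialPoly, prod_comp]
  refine Finset.prod_congr rfl fun i _ => ?_
  simp only [add_comp, one_comp, mul_comp, C_comp, X_comp, C_mul]
  ring

open Polynomial in
lemma binomialWeight_eq_coeff (N : ℕ) (q : ℝ) (k : ℕ) :
    binomialWeight N q k = (poissonBinomialPoly fun _ : Fin N => q).coeff k := by
  have e : (1 + C q * (X - 1) : Polynomial ℝ) = C q * X + C (1 - q) := by
    simp only [C_sub, C_1]; ring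
  rw [poissonBinomialPoly, Finset.prod_const, Finset.card_univ, Fintype.card_fin, e, add_pow,
    finsetSum_coeff]
  have h : ∀ j, ((C q * X) ^ j * C (1 - q) ^ (N - j) * (N.choose j : Polynomial ℝ)).coeff k =
      if k = j then (N.choose j : ℝ) * q ^ j * (1 - q) ^ (N - j) else 0 := by
    intro j
    have e' : (C q * X) ^ j * C (1 - q) ^ (N - j) * (N.choose j : Polynomial ℝ) =
        C ((N.choose j : ℝ) * q ^ j * (1 - q) ^ (N - j)) * X ^ j := by
      simp only [C_mul, C_pow, mul_pow, C_eq_natCast]; ring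
    rw [e', coeff_C_mul_X_pow]
  simp_rw [h]
  rw [Finset.sum_ite_eq]
  split_ifs with hk
  · rfl
  · rw [Finset.mem_range] at hk
    rw [binomialWeight, Nat.choose_eq_zero_of_lt (by omega)]
    simp

/-- Rounding loses less than `1`, so `N ≥ n / 3 - 1 ≥ n / 4` for `n ≥ 12`, and the second quantity
is at most `3 n / (n / 4) = 12`. Hence the sums of squares differ by `O(α ^ 2)` rather than `O(n α ^
2)`. -/
lemma binN_bounds {n : ℕ} (hn : 12 ≤ n) :
    (n : ℝ) / 4 ≤ binN n ∧ |(n : ℝ) ^ 2 / binN n - (3 * n - 2)| ≤ 12 := by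
  have hn' : (12 : ℝ) ≤ n := by exact_mod_cast hn
  have hd : (0 : ℝ) < 3 * n - 2 := by linarith
  set y := (n : ℝ) ^ 2 / (3 * (n : ℝ) - 2) with hy
  have hyd : y * (3 * n - 2) = n ^ 2 := by rw [hy, div_mul_cancel₀ _ hd.ne']
  have h3 : (n : ℝ) / 3 ≤ y := by
    rw [hy, div_le_div_iff₀ (by norm_num) hd]; nlinarith
  have h1 : (binN n : ℝ) ≤ y := Nat.floor_le (by positivity)
  have h2 : y < binN n + 1 := Nat.lt_floor_add_one _
  have h4 : (n : ℝ) / 4 ≤ binN n := by linarith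
  have hN : (0 : ℝ) < binN n := by linarith
  refine ⟨h4, ?_⟩
  have e : (n : ℝ) ^ 2 / binN n - (3 * n - 2) = (3 * n - 2) * (y - binN n) / binN n := by
    rw [← hyd]; field_simp
  rw [e, abs_of_nonneg (div_nonneg (mul_nonneg hd.le (by linarith)) hN.le), div_le_iff₀ hN]
  nlinarith

/-- The tilt `s = z - 1` which moves the mean of the law `Bi(N, M / N)` to `x`. -/
lemma binomial_tilt_mean {N M x : ℝ} (hN : 0 < N) (hM : 0 < M) (hMN : M < N) (hx : x < N) :
    N * (M / N * (1 + (x - M) * N / ((N - x) * M)) /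
      (1 + M / N * ((x - M) * N / ((N - x) * M)))) = x := by
  have h1 : N - x ≠ 0 := by linarith
  have h2 : N - M ≠ 0 := by linarith
  have e1 : 1 + M / N * ((x - M) * N / ((N - x) * M)) = (N - M) / (N - x) := by
    field_simp; ring
  have e2 : 1 + (x - M) * N / ((N - x) * M) = x * (N - M) / ((N - x) * M) := by
    field_simp; ring
  rw [e1, e2]
  field_simp

theorem theorem4
    {Ω : ℕ → Type*} [∀ n, MeasurableSpace (Ω n)]
    (P : ∀ n, Measure (Ω n)) [∀ n, IsProbabilityMeasure (P n)]
    (p : ℕ → unitInterval)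
    (η : ∀ n, Fin (n + 1) → Ω n → ℝ)
    (hη_bernoulli : ∀ n j, HasLaw (η n j) (bernoulliMeasure (1 : ℝ) 0 (p n)) (P n))
    (hη_indep : ∀ n, iIndepFun (η n) (P n))
    (x : ℕ → ℕ)
    (hp : Tendsto (fun n : ℕ => (p n : ℝ)) atTop (𝓝 0))
    (hnp : Tendsto (fun n : ℕ => (n : ℝ) * p n) atTop atTop)
    (hx : (fun n : ℕ => (x n : ℝ) - (n : ℝ) * alphaN11 (p n)) =o[atTop]
      (fun n : ℕ => min ((n : ℝ) * p n) ((n : ℝ) ^ (2 / 3 : ℝ)))) :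
    Tendsto
      (fun n : ℕ =>
        (P n).real {ω | countN11 (η n) ω = (x n : ℝ)} /
          binomialWeight (binN n) (binP n (p n)) (x n))
      atTop (𝓝 1) := by

  set α : ℕ → ℝ := fun n => alphaN11 (p n) with hα
  set t : ℕ → ℝ := fun n => (x n : ℝ) - n * α n with ht
  have hαp : ∀ n, α n = p n * (1 - p n) := fun n => rfl
  have hα0 : Tendsto α atTop (𝓝 0) := by
    have := hp.mul (hp.const_sub 1)
    simpa [hα, alphaN11] using this
  have hbase : ∀ᶠ n : ℕ in atTop, 0 < (n : ℝ) * p n ∧ (p n : ℝ) ≤ 1 / 2 ∧ 12 ≤ n := by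
    filter_upwards [hnp.eventually_gt_atTop 0,
      hp.eventually_le_const (show (0 : ℝ) < 1 / 2 by norm_num), eventually_ge_atTop 12]
      with n h1 h2 h3 using ⟨h1, h2, h3⟩
  have hαbd : ∀ᶠ n : ℕ in atTop, 0 < α n ∧ (n : ℝ) * p n ≤ 2 * (n * α n) := by
    filter_upwards [hbase] with n ⟨h1, h2, h3⟩
    have hn0 : (0 : ℝ) < n := by positivity
    have hp0 : (0 : ℝ) < p n := pos_of_mul_pos_right h1 hn0.le
    rw [hαp]
    exact ⟨mul_pos hp0 (by linarith), by nlinarith⟩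
  have hM : Tendsto (fun n : ℕ => (n : ℝ) * α n) atTop atTop := by
    refine tendsto_atTop_mono' _ ?_ (hnp.atTop_div_const (show (0 : ℝ) < 2 by norm_num))
    filter_upwards [hαbd] with n h
    linarith [h.2]
  -- The bound by `n p` makes the tilt tend to `0`. The bound by `n ^ (2 / 3)`, used next, controls
  -- the Taylor remainders.
  have htM : Tendsto (fun n => t n / (n * α n)) atTop (𝓝 0) := by
    have h2 : (fun n : ℕ => min ((n : ℝ) * p n) ((n : ℝ) ^ (2 / 3 : ℝ))) =O[atTop]
        (fun n : ℕ => (n : ℝ) * α n) := by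
      refine IsBigO.of_bound 2 ?_
      filter_upwards [hbase, hαbd] with n hb h
      have h0 : 0 ≤ min ((n : ℝ) * p n) ((n : ℝ) ^ (2 / 3 : ℝ)) :=
        le_min hb.1.le (by positivity)
      rw [Real.norm_of_nonneg h0, Real.norm_of_nonneg (by linarith [h.2, hb.1])]
      exact (min_le_left _ _).trans h.2
    exact (hx.trans_isBigO h2).tendsto_div_nhds_zero
  have htn : Tendsto (fun n : ℕ => t n / (n : ℝ) ^ (2 / 3 : ℝ)) atTop (𝓝 0) := by
    have h2 : (fun n : ℕ => min ((n : ℝ) * p n) ((n : ℝ) ^ (2 / 3 : ℝ))) =O[atTop]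
        (fun n : ℕ => (n : ℝ) ^ (2 / 3 : ℝ)) := by
      refine IsBigO.of_bound 1 ?_
      filter_upwards [hbase] with n hb
      have h0 : 0 ≤ min ((n : ℝ) * p n) ((n : ℝ) ^ (2 / 3 : ℝ)) :=
        le_min hb.1.le (by positivity)
      rw [Real.norm_of_nonneg h0, Real.norm_of_nonneg (by positivity), one_mul]
      exact min_le_right _ _
    exact (hx.trans_isBigO h2).tendsto_div_nhds_zero
  have hxM : ∀ᶠ n : ℕ in atTop, (n : ℝ) * α n / 2 ≤ x n ∧ (x n : ℝ) ≤ 2 * (n * α n) := by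
    filter_upwards [htM.abs.eventually_le_const (show |(0 : ℝ)| < 1 / 2 by norm_num),
      hM.eventually_gt_atTop 0] with n h1 h2
    rw [abs_div, abs_of_pos h2, div_le_iff₀ h2] at h1
    have h3 := abs_le.1 h1
    simp only [ht] at h3
    constructor <;> linarith [h3.1, h3.2]
  have hxtop : Tendsto x atTop atTop := by
    rw [← tendsto_natCast_atTop_iff (R := ℝ)]
    refine tendsto_atTop_mono' _ ?_ (hM.atTop_div_const (show (0 : ℝ) < 2 by norm_num))
    filter_upwards [hxM] with n h using h.1
  -- Once `α ≤ 1 / 16`, one has `x ≤ 2 n α ≤ n / 8 ≤ N / 2`.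
  have hNM : ∀ᶠ n : ℕ in atTop, (x n : ℝ) ≤ binN n / 2 ∧ (n : ℝ) * α n < binN n := by
    filter_upwards [hxM, hbase, hαbd,
      hα0.eventually_le_const (show (0 : ℝ) < 1 / 16 by norm_num)] with n h1 h2 h3 h4
    have h5 := (binN_bounds h2.2.2).1
    have hn0 : (12 : ℝ) ≤ n := by exact_mod_cast h2.2.2
    have h6 : (n : ℝ) * α n ≤ n * (1 / 16) := by gcongr
    constructor <;> linarith [h1.2]
  -- This is the tilt of `binomial_tilt_mean` with `M = n α`.
  set s : ℕ → ℝ := fun n => t n * binN n / ((binN n - x n) * (n * α n)) with hs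
  have hsbd : ∀ᶠ n : ℕ in atTop, |s n| ≤ 2 * (|t n| / (n * α n)) := by
    filter_upwards [hNM, hM.eventually_gt_atTop 0] with n h1 h2
    have h3 : (0 : ℝ) < binN n := by linarith [h1.2]
    have h4 : (0 : ℝ) < binN n - x n := by linarith [h1.1]
    rw [hs]; simp only
    rw [abs_div, abs_mul, abs_mul, abs_of_pos h2, abs_of_pos h4, abs_of_pos h3, ← mul_div_assoc,
      div_le_div_iff₀ (by positivity) h2]
    have : |t n| * (n * α n) * binN n ≤ |t n| * (n * α n) * (2 * (binN n - x n)) := by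
      gcongr; linarith [h1.1]
    linarith
  have hs0 : Tendsto s atTop (𝓝 0) := by
    have h1 := htM.abs.const_mul 2
    rw [abs_zero, mul_zero] at h1
    refine squeeze_zero_norm' ?_ h1
    filter_upwards [hsbd, hM.eventually_gt_atTop 0] with n h h2
    rw [Real.norm_eq_abs]
    refine h.trans_eq ?_
    rw [abs_div, abs_of_pos h2]
  have hr3 : ∀ n : ℕ, ((n : ℝ) ^ (2 / 3 : ℝ)) ^ 3 = (n : ℝ) ^ 2 := by
    intro n
    rw [← Real.rpow_natCast, ← Real.rpow_mul (Nat.cast_nonneg n)]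
    norm_num
  -- The bound `c = 4 α` holds since `fibRoot ≤ 4` and `N ≥ n / 4`; `Q` comes from `3 n - 2 ≤ 4 n`
  -- and `n ^ 2 / N ≤ 4 n`; the `12` in `D` is the rounding error of `binN_bounds`.
  have hmain := tendsto_coeff_div_coeff_poissonBinomialPoly (x := x) (s := s)
    (ι := fun n => Fin ((n + 1) / 2)) (κ := fun n => Fin (binN n))
    (a := fun n i => α n * fibRoot (n + 1) i) (b := fun n _ => binP n (p n))
    (c := fun n => 4 * α n) (Q := fun n => 4 * n * α n ^ 2) (D := fun n => 12 * α n ^ 2)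
    ?_ ?_ ?_ ?_ ?_ ?_ ?_ hxtop ?_ hs0 ?_ ?_ ?_
  · refine hmain.congr fun n => ?_
    rw [measureReal_countN11_eq (hη_bernoulli n) (hη_indep n), fibPoly_comp_eq_poissonBinomialPoly,
      binomialWeight_eq_coeff]
  · filter_upwards [hαbd] with n h i
    have h1 := fibRoot_pos (n + 1) i
    have h2 := fibRoot_le (n + 1) i
    exact ⟨by have := h.1; positivity, by nlinarith [h.1]⟩
  · filter_upwards [hαbd, hbase] with n h h2 i
    have h5 := (binN_bounds h2.2.2).1
    have hn0 : (12 : ℝ) ≤ n := by exact_mod_cast h2.2.2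
    have hN : (0 : ℝ) < binN n := by linarith
    change 0 ≤ n * α n / binN n ∧ n * α n / binN n ≤ 4 * α n
    refine ⟨by have := h.1; positivity, ?_⟩
    rw [div_le_iff₀ hN]
    nlinarith [h.1]
  · filter_upwards [hbase] with n h2
    have h5 := (binN_bounds h2.2.2).1
    have hn0 : (12 : ℝ) ≤ n := by exact_mod_cast h2.2.2
    have hN : (0 : ℝ) < binN n := by linarith
    rw [← Finset.mul_sum, sum_fibRoot]
    simp only [Finset.sum_const, Finset.card_univ, Fintype.card_fin, nsmul_eq_mul, binP]
    field_simp
    rfl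
  · filter_upwards [hbase] with n h2
    simp only [mul_pow]
    rw [← Finset.mul_sum, sum_fibRoot_sq n (by omega)]
    nlinarith [sq_nonneg (α n), (Nat.cast_nonneg n : (0 : ℝ) ≤ n)]
  · filter_upwards [hbase] with n h2
    have h5 := (binN_bounds h2.2.2).1
    have hn0 : (12 : ℝ) ≤ n := by exact_mod_cast h2.2.2
    have hN : (0 : ℝ) < binN n := by linarith
    simp only [Finset.sum_const, Finset.card_univ, Fintype.card_fin, nsmul_eq_mul]
    change binN n * (n * α n / binN n) ^ 2 ≤ _
    have e : binN n * (n * α n / binN n) ^ 2 = n ^ 2 * α n ^ 2 / binN n := by field_simp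
    rw [e, div_le_iff₀ hN]
    have : (n : ℝ) * α n ^ 2 * (n / 4) ≤ n * α n ^ 2 * binN n := by gcongr
    nlinarith
  · filter_upwards [hbase] with n h2
    have h5 := (binN_bounds h2.2.2).1
    have h6 := (binN_bounds h2.2.2).2
    have hn0 : (12 : ℝ) ≤ n := by exact_mod_cast h2.2.2
    have hN : (0 : ℝ) < binN n := by linarith
    simp only [mul_pow, Finset.sum_const, Finset.card_univ, Fintype.card_fin, nsmul_eq_mul]
    rw [← Finset.mul_sum, sum_fibRoot_sq n (by omega)]
    change |_ - binN n * (n * α n / binN n) ^ 2| ≤ _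
    have e : α n ^ 2 * (3 * (n : ℝ) - 2) - binN n * (n * α n / binN n) ^ 2 =
        -(α n ^ 2 * ((n : ℝ) ^ 2 / binN n - (3 * n - 2))) := by field_simp; ring
    rw [e, abs_neg, abs_mul, abs_of_nonneg (sq_nonneg _), mul_comm 12]
    gcongr
  · filter_upwards [hNM, hM.eventually_gt_atTop 0] with n h1 h2
    have h3 : (0 : ℝ) < binN n := by linarith [h1.2]
    simp only [Finset.sum_const, Finset.card_univ, Fintype.card_fin, nsmul_eq_mul]
    exact binomial_tilt_mean h3 h2 h1.2 (by linarith [h1.1])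
  · simpa using hα0.const_mul 4
  · simpa using (hα0.pow 2).const_mul 12
  -- All powers of `α` cancel in `|s| ^ 3 c Q`, leaving at most `128 |t| ^ 3 / n ^ 2`.
  · have hlim := ((htn.abs).pow 3).const_mul 128
    rw [abs_zero, zero_pow three_ne_zero, mul_zero] at hlim
    refine squeeze_zero' ?_ ?_ hlim
    · filter_upwards [hαbd] with n h
      have := h.1; positivity
    · filter_upwards [hαbd, hsbd, hbase] with n h h2 h3
      have hn0 : (0 : ℝ) < n := by have := h3.2.2; positivity
      have hαn := h.1
      calc |s n| ^ 3 * (4 * α n) * (4 * n * α n ^ 2)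
          ≤ (2 * (|t n| / (n * α n))) ^ 3 * (4 * α n) * (4 * n * α n ^ 2) := by gcongr
        _ = 128 * (|t n| ^ 3 / (n : ℝ) ^ 2) := by field_simp; ring
        _ = 128 * |t n / (n : ℝ) ^ (2 / 3 : ℝ)| ^ 3 := by
          rw [abs_div, abs_of_nonneg (by positivity : (0 : ℝ) ≤ (n : ℝ) ^ (2 / 3 : ℝ)), div_pow,
            hr3]
  · have hlim := (htn.pow 2).const_mul 128
    rw [zero_pow two_ne_zero, mul_zero] at hlim
    refine squeeze_zero' ?_ ?_ hlim
    · filter_upwards [hαbd] with n h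
      have := h.1; positivity
    · filter_upwards [hαbd, hsbd, hbase, hxM] with n h h2 h3 h4
      have hn1 : (1 : ℝ) ≤ n := by have := h3.2.2; exact_mod_cast (by omega : 1 ≤ n)
      have hn0 : (0 : ℝ) < n := by linarith
      have hαn := h.1
      have hα1 : α n ≤ 1 := by
        rw [hαp]; nlinarith [sq_nonneg ((p n : ℝ) - 1 / 2)]
      have hx0 : 0 < √(x n : ℝ) := Real.sqrt_pos.2 (by nlinarith [mul_pos hn0 hαn, h4.1])
      set r := (n : ℝ) ^ (2 / 3 : ℝ) with hr
      have hr0 : 0 < r := by positivity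
      -- Here `r ^ 2 / n = n ^ (1 / 3)`, whose square is `r`. The squared claim follows from `α ^ 2
      -- r ≤ α n ≤ 2 x`.
      have hkey : α n * (r ^ 2 / n) ≤ 2 * √(x n : ℝ) := by
        refine le_of_sq_le_sq ?_ (by positivity)
        rw [mul_pow 2, Real.sq_sqrt (Nat.cast_nonneg _)]
        have e : (α n * (r ^ 2 / n)) ^ 2 = α n ^ 2 * r := by
          have := hr3 n
          rw [← hr] at this
          have e4 : (r ^ 2) ^ 2 = r * n ^ 2 := by rw [← this]; ring
          rw [mul_pow, div_pow, e4]
          field_simp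
        have hrn : r ≤ n := by
          calc r ≤ (n : ℝ) ^ (1 : ℝ) := Real.rpow_le_rpow_of_exponent_le hn1 (by norm_num)
            _ = n := Real.rpow_one _
        rw [e]
        have h5 : α n ^ 2 * r ≤ α n * n := by
          rw [sq]
          have : α n * α n ≤ α n * 1 := by gcongr
          calc α n * α n * r ≤ α n * 1 * n := by gcongr
            _ = _ := by ring
        nlinarith [h4.1, mul_pos hn0 hαn]
      have hs2 : s n ^ 2 ≤ (2 * (|t n| / (n * α n))) ^ 2 := by
        rw [← sq_abs]; gcongr
      rw [div_le_iff₀ hx0]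
      calc s n ^ 2 * (4 * α n) * (4 * n * α n ^ 2)
          ≤ (2 * (|t n| / (n * α n))) ^ 2 * (4 * α n) * (4 * n * α n ^ 2) := by gcongr
        _ = 64 * (t n ^ 2 / r ^ 2) * (α n * (r ^ 2 / n)) := by
          rw [mul_pow, div_pow, sq_abs]; field_simp; ring
        _ ≤ 64 * (t n ^ 2 / r ^ 2) * (2 * √(x n : ℝ)) := by gcongr
        _ = 128 * (t n / r) ^ 2 * √(x n : ℝ) := by rw [div_pow]; ring
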